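/- Let $q$ be a prime power, let $1\le\lambda\le\rho$ be integers, and let $n,r$ be positive integers with $n\lambda=r\rho$. The ensemble $\mathrm{LDPC}(\lambda,\rho;n)$ without codeword removal is defined as follows. Take $n$ variable nodes with $\lambda$ sockets each and $r$ check nodes with $\rho$ sockets each; match the $n\lambda$ variable-node sockets with the $r\rho$ check-node sockets by a uniformly random bijection, each matched pair being an edge; and label every edge, independently of the matching and of the other edges, by a uniformly random element $g_e$ of $\mathrm{GF}(q)\setminus\{0\}$. The random code $\boldsymbol C$ is the set of all $u\in\mathrm{GF}(q)^n$ such that, for every check node $j$, $\sum_{e}g_e u_{i(e)}=0$, where the sum is over all edges $e$ at $j$ (parallel edges counted separately) and $i(e)$ is the variable node of $e$. Let $R=1-\lambda/\rho$ be the design rate and $R_{\boldsymbol C}=\frac1n\log_q|\boldsymbol C|$ the actual rate. For fixed $q,\lambda,\rho$ and any $\epsilon>0$ there exists an integer $n(\epsilon)$ such that, for all $n>n(\epsilon)$ with $\rho\mid n\lambda$, $$\Pr[R_{\boldsymbol C}-R>\epsilon]\le q^{-n\epsilon/2}.$$ In addition, for any $\epsilon>0$ there exists $T_0>0$ such that,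 for all $n>n(\epsilon)$ with $\rho\mid n\lambda$, $$\mathbb E[R_{\boldsymbol C}-R]\le T_0\,\frac{\log_q n}{n}.$$ -/

import Mathlib

open MeasureTheory ProbabilityTheory
open scoped BigOperators

namespace LDPC

/-- A labelled `(l, d)`-regular bipartite Tanner multigraph with `n` variable nodes and `r` check
nodes, with edge constants in `F \ {0}`, as produced by the socket (permutation) construction.
Variable node `i` has the sockets `(i, s)`, `s : Fin l`; check node `j` has the sockets `(j, t)`,
`t : Fin d`; the bijection `perm` matches the variable-node sockets with the check-node sockets.
An edge is identified with its variable-node socket `e`: it joins the variable node `e.1` to the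
check node `(perm e).1` and carries the nonzero constant `label e`. -/
structure TannerGraph (F : Type*) [Field F] (l d n r : ℕ) where
  perm : (Fin n × Fin l) ≃ (Fin r × Fin d)
  label : Fin n × Fin l → Fˣ

namespace TannerGraph

variable {F : Type*} [Field F] {l d n r : ℕ}

/-- The edges incident to check node `j` (parallel edges are kept as separate edges). -/
def edgesAt (G : TannerGraph F l d n r) (j : Fin r) : Finset (Fin n × Fin l) :=
  Finset.univ.filter fun e => (G.perm e).1 = j

/-- The full codebook: all vectors satisfying the parity check of every check node. -/
def codebook (G : TannerGraph F l d n r) : Set (Fin n → F) :=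
  {u | ∀ j : Fin r, ∑ e ∈ G.edgesAt j, (G.label e : F) * u e.1 = 0}

/-- The actual rate of the code, in `q`-ary symbols per channel use (`q = |F|`): the number of
codewords is `q ^ (n * rate)`. -/
noncomputable def rate [Fintype F] (G : TannerGraph F l d n r) : ℝ :=
  Real.logb (Fintype.card F) (G.codebook.ncard) / n

instance : MeasurableSpace (TannerGraph F l d n r) := ⊤

instance : DiscreteMeasurableSpace (TannerGraph F l d n r) := ⟨fun _ => trivial⟩

instance [Fintype F] : Finite (TannerGraph F l d n r) :=
  Finite.of_injective
    (fun G : TannerGraph F l d n r => (G.perm, G.label))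
    (fun G H h => by
      cases G; cases H
      simpa using h)

theorem nonempty (h : n * l = r * d) : Nonempty (TannerGraph F l d n r) :=
  ⟨⟨Fintype.equivOfCardEq (by simpa using h), fun _ => 1⟩⟩

end TannerGraph

/-- The design rate `1 - l / d` of the `(l, d)`-regular ensemble. -/
noncomputable def designRate (l d : ℕ) : ℝ := 1 - (l : ℝ) / (d : ℝ)

/-- The random ensemble without codeword removal: the socket matching is uniform over all
matchings, and the edge constants are independent and uniform over the nonzero field elements.
Jointly, this is the uniform distribution on labelled Tanner graphs. It is a probability measure
whenever `n * l = r * d`. -/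
noncomputable def fullEnsemble (F : Type*) [Field F] (l d n r : ℕ) :
    Measure (TannerGraph F l d n r) :=
  uniformOn Set.univ

theorem isProbabilityMeasure_fullEnsemble (F : Type*) [Field F] [Fintype F] {l d n r : ℕ}
    (h : n * l = r * d) : IsProbabilityMeasure (fullEnsemble F l d n r) := by
  have : Nonempty (TannerGraph F l d n r) := TannerGraph.nonempty h
  exact isProbabilityMeasure_uniformOn Set.finite_univ Set.univ_nonempty

end LDPC

set_option linter.unusedSectionVars false

namespace LDPC

/-! The expected number of codewords is at most `(n l + 1)(n + 1) q^(n R)`. Markov's inequality then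
gives the tail bound, and concavity of the logarithm the bound on the mean rate; both lose only the
polynomial factor. A word `u` of weight `w` reaches the check sockets as a uniform word of weight `w
l`, so `P(u ∈ C) = K / T`, with `T` the size of that sphere and `K` the number of its words passing
every check. Let `D` be the probability of `u` under the memoryless law of mean weight `w`. A
binomial law is heaviest at its mean, so `T D^l ≥ 1/(n l + 1)` (`one_le_card_sphere_mul`). A
Loomis-Whitney argument at each check gives `K (D^l)^(1 - 1/d) ≤ 1` (`card_checkWords_mul_le`).
Hence `P(u ∈ C) ≤ (n l + 1) D^(l/d)`, and interpolation bounds the sum over each sphere in `F^n` by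
`q^(n(1 - l/d))`; there are `n + 1` spheres. -/

theorem sum_prod_eq_one {F ι : Type*} [Fintype F] [Fintype ι] [DecidableEq ι] {f : F → ℝ}
    (h1 : ∑ x, f x = 1) :
    ∑ v : ι → F, ∏ i, f (v i) = 1 := by
  have := Finset.prod_univ_sum (fun _ : ι => (Finset.univ : Finset F)) (fun _ x => f x)
  simp only [Fintype.piFinset_univ] at this
  rw [← this]
  simp [h1]

/-! ### Words of given Hamming weight -/

section Words

variable {F : Type*} [Field F] [DecidableEq F] {ι : Type*} [Fintype ι]

/-- Two words of equal Hamming weight differ by a monomial transformation. -/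
theorem exists_monomial_of_hammingNorm_eq (v w : ι → F) (h : hammingNorm v = hammingNorm w) :
    ∃ (σ : Equiv.Perm ι) (a : ι → Fˣ), ∀ s, w (σ s) = a s * v s := by
  have hc : Fintype.card {i // v i ≠ 0} = Fintype.card {i // w i ≠ 0} := by
    simpa [hammingNorm, Fintype.card_subtype] using h
  -- A bijection between the supports, later extended to a permutation of all coordinates.
  let e : {i // v i ≠ 0} ≃ {i // w i ≠ 0} := Fintype.equivOfCardEq hc
  have h1 : ∀ s, v s ≠ 0 → w (e.extendSubtype s) ≠ 0 := fun s hs => e.extendSubtype_mem s hs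
  have h2 : ∀ s, ¬ v s ≠ 0 → ¬ w (e.extendSubtype s) ≠ 0 :=
    fun s hs => e.extendSubtype_not_mem s hs
  refine ⟨e.extendSubtype, fun s => if hs : v s ≠ 0 then
    Units.mk0 (w (e.extendSubtype s) / v s) (div_ne_zero (h1 s hs) hs) else 1, fun s => ?_⟩
  by_cases hs : v s ≠ 0
  · simp only [dif_pos hs, Units.val_mk0]
    field_simp
  · have := h2 s hs
    push Not at this hs
    simp [this, hs]

theorem prod_ite_zero_eq (α β : ℝ) (v : ι → F) :
    ∏ i, (if v i = 0 then α else β) =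
      α ^ (Fintype.card ι - hammingNorm v) * β ^ hammingNorm v := by
  rw [Finset.prod_ite, Finset.prod_const, Finset.prod_const]
  congr 2
  have := Finset.card_filter_add_card_filter_not (s := (Finset.univ : Finset ι)) (fun i => v i = 0)
  rw [Finset.card_univ] at this
  simp only [hammingNorm]
  simp only [ne_eq]
  omega

variable [Fintype F]

theorem sum_ite_zero_eq (α β : ℝ) :
    ∑ x : F, (if x = 0 then α else β) = α + (Fintype.card F - 1) * β := by
  rw [← Finset.add_sum_erase _ _ (Finset.mem_univ (0 : F))]
  rw [Finset.sum_congr rfl (g := fun _ => β) (fun x hx => by simp [Finset.ne_of_mem_erase hx])]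
  simp [Finset.card_erase_of_mem, Nat.cast_sub Fintype.card_pos]

variable [DecidableEq ι]

theorem card_words_with_support (s : Finset ι) :
    (Finset.univ.filter fun v : ι → F => (Finset.univ.filter fun i => v i ≠ 0) = s).card
      = (Fintype.card F - 1) ^ s.card := by
  have : (Finset.univ.filter fun v : ι → F => (Finset.univ.filter fun i => v i ≠ 0) = s)
      = Fintype.piFinset fun i => if i ∈ s then Finset.univ.erase (0 : F) else {0} := by
    ext v
    simp only [Finset.mem_filter, Finset.mem_univ, true_and, Fintype.mem_piFinset, Finset.ext_iff]
    refine forall_congr' fun i => ?_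
    by_cases hi : i ∈ s <;> simp [hi]
  rw [this, Fintype.card_piFinset]
  have h : ∀ i, (if i ∈ s then Finset.univ.erase (0 : F) else {0}).card =
      if i ∈ s then Fintype.card F - 1 else 1 := by
    intro i; split_ifs <;> simp [Finset.card_erase_of_mem]
  simp [h]

/-- The size of a Hamming sphere. -/
theorem card_hammingNorm_eq (k : ℕ) :
    (Finset.univ.filter fun v : ι → F => hammingNorm v = k).card
      = (Fintype.card ι).choose k * (Fintype.card F - 1) ^ k := by
  rw [Finset.card_eq_sum_card_fiberwise (t := Finset.powersetCard k Finset.univ)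
    (f := fun v : ι → F => Finset.univ.filter fun i => v i ≠ 0)]
  · rw [Finset.sum_congr rfl (g := fun _ => (Fintype.card F - 1) ^ k)]
    · simp [Finset.card_powersetCard]
    · intro s hs
      rw [Finset.mem_powersetCard] at hs
      rw [← hs.2, ← card_words_with_support (F := F) s, Finset.filter_filter]
      congr 1
      refine Finset.filter_congr fun v _ => ⟨fun h => h.2, fun h => ⟨?_, h⟩⟩
      rw [← h]; rfl
  · intro v hv
    simpa [hammingNorm] using hv

end Words

/-! ### The mode of a binomial law -/

/-- The terms of the binomial expansion of `(a + b) ^ N` with `a : b = N - W : W` are largest at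
index `W`. -/
theorem choose_mul_pow_le_mode {N W : ℕ} (hW : W ≤ N) (k : ℕ) (hk : k ≤ N) :
    N.choose k * W ^ k * (N - W) ^ (N - k) ≤ N.choose W * W ^ W * (N - W) ^ (N - W) := by
  obtain rfl | hW0 := Nat.eq_zero_or_pos W
  · obtain rfl | hk0 := Nat.eq_zero_or_pos k
    · rfl
    · simp [zero_pow hk0.ne']
  obtain rfl | hWN := hW.eq_or_lt
  · obtain rfl | hkN := hk.eq_or_lt
    · rfl
    · simp [zero_pow (Nat.sub_ne_zero_of_lt hkN)]
  set t : ℕ → ℕ := fun k => N.choose k * W ^ k * (N - W) ^ (N - k) with ht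
  have hM : 0 < N - W := by omega
  -- The ratio of consecutive terms, cross-multiplied to stay in `ℕ`. It is at least 1 for `k < W`
  -- and at most 1 for `k ≥ W`.
  have hrec : ∀ k, k < N → t (k + 1) * ((k + 1) * (N - W)) = t k * ((N - k) * W) := by
    intro k hk
    have e : N - k = (N - (k + 1)) + 1 := by omega
    have := Nat.choose_succ_right_eq N k
    simp only [ht]
    calc _ = (N.choose (k + 1) * (k + 1)) * W ^ (k + 1) * (N - W) ^ (N - (k + 1) + 1) := by ring
      _ = _ := by rw [this, ← e]; ring
  change t k ≤ t W
  rcases le_total k W with h | h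
  · refine Nat.decreasingInduction' (P := fun k => t k ≤ t W) (fun k hk1 _ ih => ?_) h le_rfl
    refine le_trans ?_ ih
    have hr := hrec k (by omega)
    have hle : (k + 1) * (N - W) ≤ (N - k) * W := by
      zify [hWN.le, (by omega : k ≤ N)]
      have : (k : ℤ) + 1 ≤ W := by exact_mod_cast hk1
      have hN : (0 : ℤ) ≤ N := by positivity
      nlinarith [mul_le_mul_of_nonneg_right this hN]
    have hpos : 0 < (k + 1) * (N - W) := by positivity
    refine Nat.le_of_mul_le_mul_right ?_ hpos
    rw [hr]
    exact Nat.mul_le_mul_left _ hle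
  · revert hk
    refine Nat.le_induction (P := fun k _ => k ≤ N → t k ≤ t W) (fun _ => le_rfl)
      (fun k hk1 ih hk => ?_) k h
    refine le_trans ?_ (ih (by omega))
    have hr := hrec k (by omega)
    have hle : (N - k) * W ≤ (k + 1) * (N - W) := by
      zify [hWN.le, (by omega : k ≤ N)]
      have h1 : (W : ℤ) ≤ k := by exact_mod_cast hk1
      have hN : (0 : ℤ) ≤ N := by positivity
      have hWN' : (W : ℤ) ≤ N := by exact_mod_cast hWN.le
      nlinarith [mul_le_mul_of_nonneg_right h1 hN]
    have hpos : 0 < (k + 1) * (N - W) := by positivity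
    refine Nat.le_of_mul_le_mul_right ?_ hpos
    rw [hr]
    exact Nat.mul_le_mul_left _ hle

/-- Expand `(W + (N - W))^N` into `N + 1` terms, each at most the mode. -/
theorem pow_self_le_mode {N W : ℕ} (hW : W ≤ N) :
    N ^ N ≤ (N + 1) * (N.choose W * W ^ W * (N - W) ^ (N - W)) := by
  have h := add_pow W (N - W) N
  rw [Nat.add_sub_cancel' hW] at h
  rw [h]
  calc _ ≤ ∑ _k ∈ Finset.range (N + 1), N.choose W * W ^ W * (N - W) ^ (N - W) := by
        refine Finset.sum_le_sum fun k hk => ?_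
        refine le_trans (le_of_eq ?_)
          (choose_mul_pow_le_mode hW k (by simpa [Nat.lt_succ_iff] using hk))
        simp only [Nat.cast_id]; ring
    _ = _ := by simp

/-- Under the memoryless law whose mean weight is `W`, the Hamming sphere of radius `W` has
probability at least `1 / (N + 1)`. -/
theorem one_le_card_sphere_mul {N W : ℕ} (hN : 0 < N) (hW : W ≤ N) {m : ℝ} (hm : 0 < m) :
    1 ≤ (N + 1 : ℝ) * (N.choose W * m ^ W) *
      ((1 - (W : ℝ) / N) ^ (N - W) * ((W : ℝ) / N / m) ^ W) := by
  have h : (N : ℝ) ^ N ≤ (N + 1) * (N.choose W * W ^ W * (N - W : ℝ) ^ (N - W)) := by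
    have := pow_self_le_mode hW
    rw [← Nat.cast_sub hW]
    exact_mod_cast this
  have hN' : (0 : ℝ) < N := by exact_mod_cast hN
  have e1 : 1 - (W : ℝ) / N = (N - W) / N := by field_simp
  have e2 : (N : ℝ) ^ (N - W) * (N : ℝ) ^ W = (N : ℝ) ^ N := by
    rw [← pow_add, Nat.sub_add_cancel hW]
  have e3 : (N + 1 : ℝ) * (N.choose W * m ^ W) *
      ((1 - (W : ℝ) / N) ^ (N - W) * ((W : ℝ) / N / m) ^ W)
      = ((N + 1) * (N.choose W * W ^ W * (N - W : ℝ) ^ (N - W))) / (N : ℝ) ^ N := by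
    rw [e1, ← e2, div_pow, div_pow, div_pow]
    field_simp
  rw [e3, le_div_iff₀ (by positivity), one_mul]
  exact h

end LDPC

namespace LDPC

/-! ### Counting words that satisfy the parity checks -/

section CheckCode

variable {F : Type*} [Field F] [Fintype F] [DecidableEq F]

theorem prod_prod_erase {ι : Type*} [Fintype ι] [DecidableEq ι] (x : ι → ℝ) :
    ∏ i, ∏ j ∈ Finset.univ.erase i, x j = ∏ j, x j ^ (Fintype.card ι - 1) := by
  rw [Finset.prod_comm' (s' := fun j => Finset.univ.erase j) (t' := Finset.univ)]
  · simp [Finset.card_erase_of_mem]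
  · intro i j; simp [ne_comm]

/-- Any one symbol of a parity-check word is determined by the others, so deleting coordinate `i` is
injective and the sum is part of a total mass 1. -/
theorem sum_parity_prod_erase_le {d : ℕ} {f : F → ℝ} (h0 : ∀ x, 0 ≤ f x) (h1 : ∑ x, f x = 1)
    (i : Fin d) :
    ∑ c : Fin d → F with ∑ t, c t = 0, ∏ j ∈ Finset.univ.erase i, f (c j) ≤ 1 := by
  obtain _ | k := d
  · exact i.elim0
  have e : ∀ c : Fin (k + 1) → F, ∏ j ∈ Finset.univ.erase i, f (c j)
      = ∏ j : Fin k, f (c (i.succAbove j)) := by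
    intro c
    have : Finset.univ.erase i = Finset.univ.map i.succAboveEmb := by
      ext j
      simp [Fin.exists_succAbove_eq_iff]
    rw [this, Finset.prod_map]
    rfl
  simp only [e]
  rw [← sum_prod_eq_one (ι := Fin k) h1]
  have inj : Set.InjOn (fun (c : Fin (k + 1) → F) (j : Fin k) => c (i.succAbove j))
      (Finset.univ.filter fun c : Fin (k + 1) → F => ∑ t, c t = 0) := by
    intro c hc c' hc' h
    simp only [Finset.coe_filter, Finset.mem_univ, true_and, Set.mem_ofPred_eq] at hc hc'
    rw [Fin.sum_univ_succAbove _ i] at hc hc'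
    have h' : ∀ j, c (i.succAbove j) = c' (i.succAbove j) := fun j => congrFun h j
    have hi : c i = c' i := by
      simp only [h'] at hc
      exact add_right_cancel (hc.trans hc'.symm)
    funext t
    rcases eq_or_ne t i with rfl | ht
    · exact hi
    · obtain ⟨j, rfl⟩ := Fin.exists_succAbove_eq ht
      exact h' j
  rw [← Finset.sum_image (f := fun w : Fin k → F => ∏ j, f (w j)) inj]
  exact Finset.sum_le_sum_of_subset_of_nonneg (Finset.subset_univ _)
    fun _ _ _ => Finset.prod_nonneg fun _ _ => h0 _

/-- A Loomis-Whitney type bound for the single parity check code of length `d`. -/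
theorem sum_parity_prod_rpow_le {d : ℕ} (hd : 0 < d) {f : F → ℝ} (h0 : ∀ x, 0 ≤ f x)
    (h1 : ∑ x, f x = 1) :
    ∑ c : Fin d → F with ∑ t, c t = 0, ∏ t, f (c t) ^ (1 - 1 / (d : ℝ)) ≤ 1 := by
  have hd' : (0 : ℝ) < d := by exact_mod_cast hd
  -- The left side is the geometric mean of the `d` products with one coordinate deleted: each
  -- factor occurs in `d - 1` of them.
  have amgm : ∀ c : Fin d → F, ∏ t, f (c t) ^ (1 - 1 / (d : ℝ))
      ≤ ∑ i, (1 / (d : ℝ)) * ∏ j ∈ Finset.univ.erase i, f (c j) := by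
    intro c
    refine le_trans (le_of_eq ?_) (Real.geom_mean_le_arith_mean_weighted Finset.univ
      (fun _ => 1 / (d : ℝ)) (fun i => ∏ j ∈ Finset.univ.erase i, f (c j))
      (fun _ _ => by positivity) (by simp; field_simp)
      (fun _ _ => Finset.prod_nonneg fun _ _ => h0 _))
    rw [Real.finsetProd_rpow _ _ (fun i _ => Finset.prod_nonneg fun _ _ => h0 _),
      prod_prod_erase (fun j => f (c j)), Finset.prod_pow,
      Real.finsetProd_rpow _ _ (fun i _ => h0 _), ← Real.rpow_natCast,
      ← Real.rpow_mul (Finset.prod_nonneg fun _ _ => h0 _)]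
    congr 1
    rw [Fintype.card_fin, Nat.cast_sub hd]
    field_simp
    simp
  calc _ ≤ ∑ c : Fin d → F with ∑ t, c t = 0,
        ∑ i, (1 / (d : ℝ)) * ∏ j ∈ Finset.univ.erase i, f (c j) :=
        Finset.sum_le_sum fun c _ => amgm c
    _ = ∑ i : Fin d, (1 / (d : ℝ)) * ∑ c : Fin d → F with ∑ t, c t = 0,
          ∏ j ∈ Finset.univ.erase i, f (c j) := by
        rw [Finset.sum_comm]; simp only [Finset.mul_sum]
    _ ≤ ∑ _i : Fin d, (1 / (d : ℝ)) * 1 :=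
        Finset.sum_le_sum fun i _ =>
          mul_le_mul_of_nonneg_left (sum_parity_prod_erase_le h0 h1 i) (by positivity)
    _ = 1 := by simp; field_simp

/-- The words on the check sockets which satisfy all parity checks. -/
def checkWords (F : Type*) [Field F] [Fintype F] [DecidableEq F] (r d : ℕ) :
    Finset (Fin r × Fin d → F) :=
  Finset.univ.filter fun v => ∀ j, ∑ t, v (j, t) = 0

/-- The checks use disjoint sockets, so the sum factors over the check nodes. -/
theorem sum_checkWords_prod_rpow_le {r d : ℕ} (hd : 0 < d) {f : F → ℝ} (h0 : ∀ x, 0 ≤ f x)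
    (h1 : ∑ x, f x = 1) :
    ∑ v ∈ checkWords F r d, ∏ s, f (v s) ^ (1 - 1 / (d : ℝ)) ≤ 1 := by
  have key : ∑ v ∈ checkWords F r d, ∏ s, f (v s) ^ (1 - 1 / (d : ℝ))
      = ∏ _j : Fin r, ∑ c : Fin d → F with ∑ t, c t = 0, ∏ t, f (c t) ^ (1 - 1 / (d : ℝ)) := by
    rw [Finset.prod_univ_sum]
    refine Finset.sum_bij' (fun v _ => Function.curry v) (fun w _ => Function.uncurry w)
      ?_ ?_ ?_ ?_ ?_
    · intro v hv
      simpa [checkWords] using hv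
    · intro w hw
      simpa [checkWords] using hw
    · intro v _; simp
    · intro v _; simp
    · intro v _
      rw [Fintype.prod_prod_type]
      rfl
  rw [key]
  exact Finset.prod_le_one
    (fun _ _ => Finset.sum_nonneg fun _ _ => Finset.prod_nonneg fun _ _ => Real.rpow_nonneg (h0 _) _)
    (fun _ _ => sum_parity_prod_rpow_le hd h0 h1)

/-- The number of check words of weight `W`, against the memoryless law `f`. -/
theorem card_checkWords_mul_le {r d W : ℕ} (hd : 0 < d) {α β : ℝ} (hα : 0 ≤ α) (hβ : 0 ≤ β)
    (h1 : α + (Fintype.card F - 1) * β = 1) :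
    (((checkWords F r d).filter fun v => hammingNorm v = W).card : ℝ) *
      (α ^ (r * d - W) * β ^ W) ^ (1 - 1 / (d : ℝ)) ≤ 1 := by
  have h0 : ∀ x : F, 0 ≤ if x = 0 then α else β := fun x => by split_ifs <;> assumption
  refine le_trans ?_ (sum_checkWords_prod_rpow_le (F := F) (r := r) hd h0
    (by rw [sum_ite_zero_eq, h1]))
  calc _ = ∑ v ∈ (checkWords F r d).filter (fun v => hammingNorm v = W),
        ∏ s, (if v s = 0 then α else β) ^ (1 - 1 / (d : ℝ)) := by
        rw [Finset.sum_congr rfl (g := fun _ => (α ^ (r * d - W) * β ^ W) ^ (1 - 1 / (d : ℝ)))]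
        · simp
        · intro v hv
          rw [Real.finsetProd_rpow _ _ (fun i _ => h0 _), prod_ite_zero_eq,
            (Finset.mem_filter.1 hv).2]
          simp
    _ ≤ _ := Finset.sum_le_sum_of_subset_of_nonneg (Finset.filter_subset _ _)
        fun _ _ _ => Finset.prod_nonneg fun _ _ => Real.rpow_nonneg (h0 _) _

end CheckCode

end LDPC

namespace LDPC

/-! ### The socket word and its monomial symmetry -/

namespace TannerGraph

variable {F : Type*} [Field F] {l d n r : ℕ}

/-- The word which the check sockets receive from the assignment `u` of the variable nodes. -/
def socketWord (G : TannerGraph F l d n r) (u : Fin n → F) (s : Fin r × Fin d) : F :=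
  G.label (G.perm.symm s) * u (G.perm.symm s).1

/-- The action of a monomial transformation of the check sockets on Tanner graphs. -/
def monomialMap (σ : Equiv.Perm (Fin r × Fin d)) (a : Fin r × Fin d → Fˣ)
    (G : TannerGraph F l d n r) : TannerGraph F l d n r :=
  ⟨G.perm.trans σ, fun e => a (G.perm e) * G.label e⟩

theorem monomialMap_injective (σ : Equiv.Perm (Fin r × Fin d)) (a : Fin r × Fin d → Fˣ) :
    Function.Injective (monomialMap (F := F) (l := l) (n := n) σ a) := by
  rintro ⟨p, g⟩ ⟨p', g'⟩ h
  simp only [monomialMap, mk.injEq] at h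
  obtain ⟨h1, h2⟩ := h
  have hp : p = p' := by
    ext1 e
    exact σ.injective (DFunLike.congr_fun h1 e)
  subst hp
  simp only [mk.injEq, true_and]
  funext e
  exact mul_left_cancel (congrFun h2 e)

theorem socketWord_monomialMap (σ : Equiv.Perm (Fin r × Fin d)) (a : Fin r × Fin d → Fˣ)
    (G : TannerGraph F l d n r) (u : Fin n → F) (s : Fin r × Fin d) :
    (monomialMap σ a G).socketWord u (σ s) = a s * G.socketWord u s := by
  simp [socketWord, monomialMap, mul_assoc]

theorem hammingNorm_socketWord [DecidableEq F] (G : TannerGraph F l d n r) (u : Fin n → F) :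
    hammingNorm (G.socketWord u) = hammingNorm u * l := by
  have h1 : (Finset.univ.filter fun s => G.socketWord u s ≠ 0)
      = ((Finset.univ.filter fun i => u i ≠ 0) ×ˢ (Finset.univ : Finset (Fin l))).map
          G.perm.toEmbedding := by
    ext s
    simp [socketWord]
  simp only [hammingNorm]
  rw [h1]
  simp

theorem mem_codebook_iff [Fintype F] [DecidableEq F] (G : TannerGraph F l d n r)
    (u : Fin n → F) : u ∈ G.codebook ↔ G.socketWord u ∈ checkWords F r d := by
  have h : ∀ j, ∑ e ∈ G.edgesAt j, (G.label e : F) * u e.1 = ∑ t, G.socketWord u (j, t) := by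
    intro j
    rw [edgesAt, Finset.sum_filter,
      ← Equiv.sum_comp G.perm.symm
        (fun e => if (G.perm e).1 = j then (G.label e : F) * u e.1 else 0),
      Fintype.sum_prod_type, Finset.sum_eq_single j]
    · simp [socketWord]
    · intro j' _ hj
      simp [hj]
    · simp
  simp [codebook, checkWords, h]

end TannerGraph

/-! ### The probability that a given word is a codeword -/

section Counting

variable {F : Type*} [Field F] [Fintype F] [DecidableEq F] {l d n r : ℕ}

/-- A monomial map taking `v` to `w` injects one fibre into the other. Exchanging `v` and `w` makes
the fibres over a sphere equinumerous. -/
theorem card_socketWord_fiber_le [Fintype (TannerGraph F l d n r)] (u : Fin n → F)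
    {v w : Fin r × Fin d → F} (h : hammingNorm v = hammingNorm w) :
    (Finset.univ.filter fun G : TannerGraph F l d n r => G.socketWord u = v).card ≤
      (Finset.univ.filter fun G : TannerGraph F l d n r => G.socketWord u = w).card := by
  obtain ⟨σ, a, ha⟩ := exists_monomial_of_hammingNorm_eq v w h
  refine Finset.card_le_card_of_injOn (TannerGraph.monomialMap σ a) ?_
    (TannerGraph.monomialMap_injective σ a).injOn
  intro G hG
  simp only [Finset.coe_filter, Finset.mem_univ, true_and, Set.mem_ofPred_eq] at hG ⊢
  funext s
  obtain ⟨s, rfl⟩ := σ.surjective s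
  rw [TannerGraph.socketWord_monomialMap, hG, ha]

/-- Under a uniform Tanner graph, the socket word of `u` is uniform on a Hamming sphere. -/
theorem card_codebook_mul_card_sphere [Fintype (TannerGraph F l d n r)] (u : Fin n → F)
    [DecidablePred fun G : TannerGraph F l d n r => u ∈ G.codebook] :
    (Finset.univ.filter fun G : TannerGraph F l d n r => u ∈ G.codebook).card *
      (Finset.univ.filter fun v : Fin r × Fin d → F => hammingNorm v = hammingNorm u * l).card =
    Fintype.card (TannerGraph F l d n r) *
      ((checkWords F r d).filter fun v => hammingNorm v = hammingNorm u * l).card := by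
  set W := hammingNorm u * l
  rcases isEmpty_or_nonempty (TannerGraph F l d n r) with hE | ⟨⟨G₀⟩⟩
  · simp
  -- The common fibre size, measured at the word of a reference graph.
  set c := (Finset.univ.filter fun G : TannerGraph F l d n r =>
    G.socketWord u = G₀.socketWord u).card with hc
  have fib : ∀ v : Fin r × Fin d → F, hammingNorm v = W →
      (Finset.univ.filter fun G : TannerGraph F l d n r => G.socketWord u = v).card = c := by
    intro v hv
    have h := hv.trans (G₀.hammingNorm_socketWord u).symm
    exact le_antisymm (card_socketWord_fiber_le u h) (card_socketWord_fiber_le u h.symm)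
  have total : Fintype.card (TannerGraph F l d n r) =
      (Finset.univ.filter fun v : Fin r × Fin d → F => hammingNorm v = W).card * c := by
    rw [← Finset.card_univ, Finset.card_eq_sum_card_fiberwise
      (f := fun G : TannerGraph F l d n r => G.socketWord u)
      (t := Finset.univ.filter fun v : Fin r × Fin d → F => hammingNorm v = W)
      (fun G _ => by simp [TannerGraph.hammingNorm_socketWord, W])]
    rw [Finset.sum_congr rfl fun v hv => fib v (Finset.mem_filter.1 hv).2]
    simp
  have good : (Finset.univ.filter fun G : TannerGraph F l d n r => u ∈ G.codebook).card =
      ((checkWords F r d).filter fun v => hammingNorm v = W).card * c := by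
    rw [Finset.card_eq_sum_card_fiberwise
      (f := fun G : TannerGraph F l d n r => G.socketWord u)
      (t := (checkWords F r d).filter fun v => hammingNorm v = W)
      (fun G hG => by
        simp only [Finset.coe_filter, Finset.mem_univ, true_and, Set.mem_ofPred_eq,
          TannerGraph.mem_codebook_iff] at hG ⊢
        exact ⟨hG, TannerGraph.hammingNorm_socketWord _ _⟩)]
    rw [Finset.sum_congr rfl (g := fun _ => c)]
    · simp
    · intro v hv
      rw [← fib v (Finset.mem_filter.1 hv).2, Finset.filter_filter]
      congr 1
      refine Finset.filter_congr fun G _ => ⟨fun h => h.2, fun h => ⟨?_, h⟩⟩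
      rw [TannerGraph.mem_codebook_iff, h]
      exact (Finset.mem_filter.1 hv).1
  rw [total, good]
  ring

theorem measureReal_mem_codebook_mul (h : n * l = r * d) (u : Fin n → F) :
    (fullEnsemble F l d n r).real {G | u ∈ G.codebook} *
      (Finset.univ.filter fun v : Fin r × Fin d → F => hammingNorm v = hammingNorm u * l).card =
      ((checkWords F r d).filter fun v => hammingNorm v = hammingNorm u * l).card := by
  classical
  have : Nonempty (TannerGraph F l d n r) := TannerGraph.nonempty h
  let _ : Fintype (TannerGraph F l d n r) := Fintype.ofFinite _
  have hpos : (0 : ℝ) < Fintype.card (TannerGraph F l d n r) := by exact_mod_cast Fintype.card_pos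
  have hm : (fullEnsemble F l d n r).real {G | u ∈ G.codebook} =
      (Finset.univ.filter fun G : TannerGraph F l d n r => u ∈ G.codebook).card /
        Fintype.card (TannerGraph F l d n r) := by
    have e : {G : TannerGraph F l d n r | u ∈ G.codebook} =
      ((Finset.univ.filter fun G : TannerGraph F l d n r => u ∈ G.codebook) : Finset _) := by
      ext; simp
    rw [fullEnsemble, measureReal_def, uniformOn_univ, e, Measure.count_apply_finset]
    simp
  rw [hm, div_mul_eq_mul_div, div_eq_iff hpos.ne']
  have := card_codebook_mul_card_sphere (F := F) (l := l) (d := d) (r := r) u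
  rw [mul_comm (_ : ℝ) (Fintype.card _ : ℝ)]
  exact_mod_cast this

/-- The probability of the assignment `u` under the memoryless law with mean weight that of
`u`. -/
noncomputable def sphereWeight (F : Type*) [Fintype F] (n w : ℕ) : ℝ :=
  (1 - (w : ℝ) / n) ^ (n - w) * ((w : ℝ) / n / (Fintype.card F - 1)) ^ w

theorem one_lt_card_real (F : Type*) [Field F] [Fintype F] : (1 : ℝ) < Fintype.card F := by
  exact_mod_cast Fintype.one_lt_card

theorem sphereWeight_pos (F : Type*) [Field F] [Fintype F] {w : ℕ} (hw : w ≤ n) :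
    0 < sphereWeight F n w := by
  have hq := one_lt_card_real F
  refine mul_pos ?_ ?_
  · rcases hw.eq_or_lt with rfl | h
    · simp
    · have hn : (0 : ℝ) < n := by exact_mod_cast (Nat.zero_le w).trans_lt h
      refine pow_pos (sub_pos.2 ((div_lt_one hn).2 (by exact_mod_cast h))) _
  · rcases Nat.eq_zero_or_pos w with rfl | h
    · simp
    · have hn : (0 : ℝ) < n := by exact_mod_cast h.trans_le hw
      have h' : (0 : ℝ) < w := by exact_mod_cast h
      exact pow_pos (div_pos (div_pos h' hn) (by linarith)) _

/-- In `K / T`, the bounds on `K` and `T` carry the powers `-(1 - 1/d)` and `-1` of `D^l`; what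
survives is `(D^l)^(1/d)`. -/
theorem measureReal_mem_codebook_le (h : n * l = r * d) (hn : 0 < n) (hl : 0 < l) (hd : 0 < d)
    (u : Fin n → F) :
    (fullEnsemble F l d n r).real {G | u ∈ G.codebook} ≤
      (n * l + 1) * sphereWeight F n (hammingNorm u) ^ ((l : ℝ) / d) := by
  have hq := one_lt_card_real F
  set w := hammingNorm u
  have hw : w ≤ n := by simpa using hammingNorm_le_card_fintype (x := u)
  have hn' : (0 : ℝ) < n := by exact_mod_cast hn
  have hl' : (0 : ℝ) < l := by exact_mod_cast hl
  have hd' : (0 : ℝ) < d := by exact_mod_cast hd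
  set D := sphereWeight F n w with hD
  have hD0 : 0 < D := sphereWeight_pos F hw
  have hθ : (w : ℝ) / n ≤ 1 := (div_le_one hn').2 (by exact_mod_cast hw)
  set T : ℝ := ((Finset.univ.filter fun v : Fin r × Fin d → F => hammingNorm v = w * l).card : ℝ)
  set K : ℝ := (((checkWords F r d).filter fun v => hammingNorm v = w * l).card : ℝ)
  set p := (fullEnsemble F l d n r).real {G | u ∈ G.codebook}
  have hp0 : 0 ≤ p := measureReal_nonneg
  have hpT : p * T = K := measureReal_mem_codebook_mul h u
  -- The socket word has the same relative weight as `u`, so the same symbol law serves for both.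
  have hpow : (1 - (w : ℝ) / n) ^ (n * l - w * l) * ((w : ℝ) / n / (Fintype.card F - 1)) ^ (w * l)
      = D ^ l := by
    rw [hD, sphereWeight, mul_pow, ← pow_mul, ← pow_mul, ← Nat.sub_mul]
  have hK : K * (D ^ l) ^ (1 - 1 / (d : ℝ)) ≤ 1 := by
    have := card_checkWords_mul_le (F := F) (r := r) (d := d) (W := w * l) hd
      (α := 1 - (w : ℝ) / n) (β := (w : ℝ) / n / (Fintype.card F - 1)) (by linarith)
      (div_nonneg (by positivity) (by linarith)) (by
        rw [mul_div_cancel₀ _ (by linarith : (Fintype.card F : ℝ) - 1 ≠ 0)]; ring)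
    rwa [← h, hpow] at this
  have hT : 1 ≤ (n * l + 1) * T * D ^ l := by
    have := one_le_card_sphere_mul (N := n * l) (W := w * l) (Nat.mul_pos hn hl)
      (Nat.mul_le_mul_right l hw) (m := Fintype.card F - 1) (by linarith)
    have e : ((w * l : ℕ) : ℝ) / ((n * l : ℕ) : ℝ) = w / n := by
      push_cast; field_simp
    rw [e, hpow] at this
    have hT' : T = (n * l).choose (w * l) * (Fintype.card F - 1 : ℝ) ^ (w * l) := by
      simp only [T]
      rw [card_hammingNorm_eq]
      simp [h, Nat.cast_sub Fintype.card_pos]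
    rw [hT']
    exact_mod_cast this
  have hDl : 0 < D ^ l := pow_pos hD0 l
  calc p ≤ p * ((n * l + 1) * T * D ^ l) := le_mul_of_one_le_right hp0 hT
    _ = (n * l + 1) * (K * (D ^ l) ^ (1 - 1 / (d : ℝ))) * (D ^ l) ^ (1 / (d : ℝ)) := by
        have : D ^ l = (D ^ l) ^ (1 - 1 / (d : ℝ)) * (D ^ l) ^ (1 / (d : ℝ)) := by
          rw [← Real.rpow_add hDl]; simp
        rw [← hpT]
        nth_rw 1 [this]
        ring
    _ ≤ (n * l + 1) * 1 * (D ^ l) ^ (1 / (d : ℝ)) := by gcongr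
    _ = _ := by
        rw [mul_one, ← Real.rpow_natCast, ← Real.rpow_mul hD0.le, mul_one_div]

/-- On a sphere `S`, write `|S| D^s = |S|^(1 - s) (|S| D)^s`; here `|S| ≤ q^n`, and `|S| D ≤ 1` as
the probability of `S`. -/
theorem sum_sphereWeight_rpow_le (hn : 0 < n) {s : ℝ} (hs0 : 0 ≤ s) (hs1 : s ≤ 1) :
    ∑ u : Fin n → F, sphereWeight F n (hammingNorm u) ^ s ≤
      (n + 1) * ((Fintype.card F : ℝ) ^ n) ^ (1 - s) := by
  have hq := one_lt_card_real F
  have hn' : (0 : ℝ) < n := by exact_mod_cast hn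
  have hmaps : Set.MapsTo (fun u : Fin n → F => hammingNorm u)
      (Finset.univ : Finset (Fin n → F)) (Finset.range (n + 1)) := by
    intro u _
    have : hammingNorm u ≤ n := by simpa using hammingNorm_le_card_fintype (x := u)
    simpa [Nat.lt_succ_iff] using this
  rw [← Finset.sum_fiberwise_of_maps_to hmaps]
  have term : ∀ w ∈ Finset.range (n + 1),
      ∑ u : Fin n → F with hammingNorm u = w, sphereWeight F n (hammingNorm u) ^ s ≤
        ((Fintype.card F : ℝ) ^ n) ^ (1 - s) := by
    intro w hw
    have hw : w ≤ n := by simpa [Nat.lt_succ_iff] using hw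
    have hθ : (w : ℝ) / n ≤ 1 := (div_le_one hn').2 (by exact_mod_cast hw)
    set D := sphereWeight F n w with hD
    have hD0 : 0 < D := sphereWeight_pos F hw
    set S := Finset.univ.filter fun u : Fin n → F => hammingNorm u = w with hS
    have hα : 0 ≤ 1 - (w : ℝ) / n := by linarith
    have hβ : 0 ≤ (w : ℝ) / n / (Fintype.card F - 1) := div_nonneg (by positivity) (by linarith)
    have hSD : (S.card : ℝ) * D ≤ 1 := by
      rw [← sum_prod_eq_one (ι := Fin n) (f := fun x : F =>
        if x = 0 then 1 - (w : ℝ) / n else (w : ℝ) / n / (Fintype.card F - 1)) (by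
          rw [sum_ite_zero_eq,
            mul_div_cancel₀ _ (by linarith : (Fintype.card F : ℝ) - 1 ≠ 0)]; ring)]
      calc (S.card : ℝ) * D = ∑ u ∈ S, ∏ i, (if u i = 0 then 1 - (w : ℝ) / n
            else (w : ℝ) / n / (Fintype.card F - 1)) := by
            rw [Finset.sum_congr rfl (g := fun _ => D)]
            · simp
            · intro u hu
              rw [prod_ite_zero_eq, (Finset.mem_filter.1 hu).2, hD, sphereWeight]
              simp
        _ ≤ _ := Finset.sum_le_sum_of_subset_of_nonneg (Finset.subset_univ _)
            fun _ _ _ => Finset.prod_nonneg fun _ _ => by split_ifs <;> assumption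
    have hSq : (S.card : ℝ) ≤ (Fintype.card F : ℝ) ^ n := by
      have : S.card ≤ Fintype.card (Fin n → F) := Finset.card_le_univ _
      rw [Fintype.card_fun, Fintype.card_fin] at this
      exact_mod_cast this
    rw [Finset.sum_congr rfl (g := fun _ => D ^ s)
      (fun u hu => by rw [(Finset.mem_filter.1 hu).2])]
    rw [Finset.sum_const, nsmul_eq_mul]
    rcases Nat.eq_zero_or_pos S.card with h0 | h0
    · rw [h0]; simp; positivity
    have h0' : (0 : ℝ) < S.card := by exact_mod_cast h0
    calc (S.card : ℝ) * D ^ s = (S.card : ℝ) ^ (1 - s) * ((S.card : ℝ) * D) ^ s := by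
          rw [Real.mul_rpow h0'.le hD0.le, ← mul_assoc, ← Real.rpow_add h0']
          simp
      _ ≤ ((Fintype.card F : ℝ) ^ n) ^ (1 - s) * 1 :=
          mul_le_mul (Real.rpow_le_rpow h0'.le hSq (by linarith))
            (Real.rpow_le_one (by positivity) hSD hs0) (by positivity) (by positivity)
      _ = _ := mul_one _
  refine (Finset.sum_le_sum term).trans (le_of_eq ?_)
  simp

end Counting

/-! ### From the expected number of codewords to the rate -/

section Expectation

variable {F : Type*} [Field F] [Fintype F] {l d n r : ℕ}

/-- The expected number of codewords exceeds that of the design rate at most polynomially. -/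
theorem integral_ncard_codebook_le (h : n * l = r * d) (hn : 0 < n) (hl : 0 < l) (hld : l ≤ d) :
    ∫ G, (G.codebook.ncard : ℝ) ∂(fullEnsemble F l d n r) ≤
      (n * l + 1) * (n + 1) * (Fintype.card F : ℝ) ^ (n * designRate l d) := by
  classical
  have := isProbabilityMeasure_fullEnsemble F h
  have hd : 0 < d := hl.trans_le hld
  have hd' : (0 : ℝ) < d := by exact_mod_cast hd
  have hq := one_lt_card_real F
  have e : ∀ G : TannerGraph F l d n r, (G.codebook.ncard : ℝ) =
      ∑ u : Fin n → F, Set.indicator {G : TannerGraph F l d n r | u ∈ G.codebook} 1 G := by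
    intro G
    rw [Set.ncard_eq_toFinset_card']
    simp [Set.indicator_apply]
  simp only [e]
  rw [integral_finsetSum _ fun _ _ => Integrable.of_finite]
  simp only [integral_indicator_one (MeasurableSet.of_discrete)]
  calc _ ≤ ∑ u : Fin n → F, (n * l + 1) * sphereWeight F n (hammingNorm u) ^ ((l : ℝ) / d) :=
        Finset.sum_le_sum fun u _ => measureReal_mem_codebook_le h hn hl hd u
    _ = (n * l + 1) * ∑ u : Fin n → F, sphereWeight F n (hammingNorm u) ^ ((l : ℝ) / d) := by
        rw [Finset.mul_sum]
    _ ≤ (n * l + 1) * ((n + 1) * ((Fintype.card F : ℝ) ^ n) ^ (1 - (l : ℝ) / d)) :=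
        mul_le_mul_of_nonneg_left (sum_sphereWeight_rpow_le hn (by positivity)
          ((div_le_one hd').2 (by exact_mod_cast hld))) (by positivity)
    _ = _ := by
        rw [designRate, Real.rpow_mul (by linarith), Real.rpow_natCast]
        ring

theorem TannerGraph.one_le_ncard_codebook (G : TannerGraph F l d n r) :
    (1 : ℝ) ≤ G.codebook.ncard := by
  have : 0 < G.codebook.ncard :=
    (Set.ncard_pos (Set.toFinite _)).2 ⟨0, fun j => by simp⟩
  exact_mod_cast this

/-- Markov's inequality for the number of codewords. -/
theorem measureReal_rate_gt_le (h : n * l = r * d) (hn : 0 < n) (hl : 0 < l) (hld : l ≤ d)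
    (ε : ℝ) :
    (fullEnsemble F l d n r).real {G | G.rate - designRate l d > ε} ≤
      (n * l + 1) * (n + 1) * (Fintype.card F : ℝ) ^ (-(n * ε)) := by
  have := isProbabilityMeasure_fullEnsemble F h
  have hq := one_lt_card_real F
  have hq0 : (0 : ℝ) < Fintype.card F := by linarith
  have hn' : (0 : ℝ) < n := by exact_mod_cast hn
  set a : ℝ := (Fintype.card F : ℝ) ^ (n * (designRate l d + ε)) with ha
  have ha0 : 0 < a := Real.rpow_pos_of_pos hq0 _
  have hsub : {G : TannerGraph F l d n r | G.rate - designRate l d > ε} ⊆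
      {G | a ≤ (G.codebook.ncard : ℝ)} := by
    intro G hG
    have hG' : G.rate - designRate l d > ε := hG
    have hc := G.one_le_ncard_codebook
    have h1 : n * (designRate l d + ε) ≤ Real.logb (Fintype.card F) G.codebook.ncard := by
      have h2 : designRate l d + ε ≤ G.rate := by linarith
      rw [TannerGraph.rate, le_div_iff₀ hn'] at h2
      linarith
    exact (Real.le_logb_iff_rpow_le hq (by linarith)).1 h1
  have hM := mul_meas_ge_le_integral_of_nonneg (μ := fullEnsemble F l d n r)
    (f := fun G => (G.codebook.ncard : ℝ)) (Filter.Eventually.of_forall fun G => by positivity)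
    Integrable.of_finite a
  have hM2 := hM.trans (integral_ncard_codebook_le h hn hl hld)
  refine (measureReal_mono hsub).trans ?_
  have hsplit : (Fintype.card F : ℝ) ^ (n * designRate l d) =
      a * (Fintype.card F : ℝ) ^ (-(n * ε)) := by
    rw [ha, ← Real.rpow_add hq0]; ring_nf
  rw [hsplit] at hM2
  refine le_of_mul_le_mul_left (hM2.trans (le_of_eq ?_)) ha0
  ring

/-- Jensen's inequality for the logarithm, in tangent-line form. -/
theorem integral_rate_sub_le (h : n * l = r * d) (hn : 0 < n) (hl : 0 < l) (hld : l ≤ d) :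
    ∫ G, (G.rate - designRate l d) ∂(fullEnsemble F l d n r) ≤
      Real.logb (Fintype.card F) ((n * l + 1) * (n + 1)) / n := by
  have := isProbabilityMeasure_fullEnsemble F h
  have hq := one_lt_card_real F
  have hq0 : (0 : ℝ) < Fintype.card F := by linarith
  have hlog : 0 < Real.log (Fintype.card F) := Real.log_pos hq
  have hn' : (0 : ℝ) < n := by exact_mod_cast hn
  set A : ℝ := (n * l + 1) * (n + 1) with hA
  have hA0 : 0 < A := by positivity
  set B : ℝ := A * (Fintype.card F : ℝ) ^ (n * designRate l d) with hB
  have hB0 : 0 < B := mul_pos hA0 (Real.rpow_pos_of_pos hq0 _)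
  have hlogB : Real.log B = Real.log A + n * designRate l d * Real.log (Fintype.card F) := by
    rw [hB, Real.log_mul hA0.ne' (Real.rpow_pos_of_pos hq0 _).ne', Real.log_rpow hq0]
  -- The tangent to `log` is taken at `B`, the upper bound for the mean; the linear term then
  -- integrates to a nonpositive number.
  have pt : ∀ G : TannerGraph F l d n r, G.rate - designRate l d ≤
      Real.logb (Fintype.card F) A / n +
        (n * Real.log (Fintype.card F))⁻¹ * ((G.codebook.ncard : ℝ) / B - 1) := by
    intro G
    have hc := G.one_le_ncard_codebook
    have h1 := Real.log_le_sub_one_of_pos (div_pos (by linarith : (0 : ℝ) < G.codebook.ncard) hB0)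
    rw [Real.log_div (by linarith) hB0.ne', hlogB] at h1
    have h2 : G.rate - designRate l d - Real.logb (Fintype.card F) A / n =
        (n * Real.log (Fintype.card F))⁻¹ * (Real.log G.codebook.ncard -
          (Real.log A + n * designRate l d * Real.log (Fintype.card F))) := by
      rw [TannerGraph.rate, Real.logb, Real.logb]
      field_simp
      ring
    have h3 := mul_le_mul_of_nonneg_left h1
      (by positivity : 0 ≤ (n * Real.log (Fintype.card F))⁻¹)
    linarith
  have hI := integral_ncard_codebook_le (F := F) h hn hl hld
  calc _ ≤ ∫ G, (Real.logb (Fintype.card F) A / n +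
        (n * Real.log (Fintype.card F))⁻¹ * ((G.codebook.ncard : ℝ) / B - 1))
          ∂(fullEnsemble F l d n r) :=
        integral_mono Integrable.of_finite Integrable.of_finite pt
    _ = Real.logb (Fintype.card F) A / n + (n * Real.log (Fintype.card F))⁻¹ *
        ((∫ G, (G.codebook.ncard : ℝ) ∂(fullEnsemble F l d n r)) / B - 1) := by
        rw [integral_add Integrable.of_finite Integrable.of_finite, integral_const_mul,
          integral_sub Integrable.of_finite Integrable.of_finite]
        simp [integral_div]
    _ ≤ _ := by
        have h1 : (∫ G, (G.codebook.ncard : ℝ) ∂(fullEnsemble F l d n r)) / B - 1 ≤ 0 := by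
          rw [sub_nonpos, div_le_one hB0]
          exact hI
        have := mul_nonpos_of_nonneg_of_nonpos
          (by positivity : 0 ≤ (n * Real.log (Fintype.card F))⁻¹) h1
        linarith

end Expectation

end LDPC

/-! ### Absorbing the polynomial factor -/

theorem mainTheorem10 (F : Type*) [Field F] [Fintype F] (l d : ℕ) (hl : 1 ≤ l) (hld : l ≤ d)
    (ε : ℝ) (hε : 0 < ε) :
    ∃ N : ℕ,
      (∀ n r : ℕ, N < n → n * l = r * d →
        (LDPC.fullEnsemble F l d n r).real {G | G.rate - LDPC.designRate l d > ε}
          ≤ (Fintype.card F : ℝ) ^ (-((n : ℝ) * ε / 2))) ∧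
      ∃ T₀ : ℝ, 0 < T₀ ∧ ∀ n r : ℕ, N < n → n * l = r * d →
        ∫ G, (G.rate - LDPC.designRate l d) ∂(LDPC.fullEnsemble F l d n r)
          ≤ T₀ * (Real.logb (Fintype.card F) n / n) := by
  have hq := LDPC.one_lt_card_real F
  have hq0 : (0 : ℝ) < Fintype.card F := by linarith
  have hb : 1 < (Fintype.card F : ℝ) ^ (ε / 2) := Real.one_lt_rpow hq (by positivity)
  -- Beyond `M`, `n^3 ≤ q^(n ε / 2)`: half of the exponent `n ε` pays for the polynomial.
  obtain ⟨M, hM⟩ := Filter.eventually_atTop.1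
    ((tendsto_pow_const_div_const_pow_of_one_lt 3 hb).eventually_le_const one_pos)
  -- The factor is quadratic in `n`; a third power absorbs its constant, and this degree becomes `T₀
  -- = 3`.
  have poly : ∀ n : ℕ, 2 * (l + 1) < n → ((n * l + 1) * (n + 1) : ℝ) ≤ (n : ℝ) ^ 3 := by
    intro n hn
    have hnat : (n * l + 1) * (n + 1) ≤ n ^ 3 := by
      calc (n * l + 1) * (n + 1) ≤ (n * (l + 1)) * (2 * n) :=
            Nat.mul_le_mul (by nlinarith) (by omega)
        _ = n ^ 2 * (2 * (l + 1)) := by ring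
        _ ≤ n ^ 2 * n := Nat.mul_le_mul_left _ hn.le
        _ = n ^ 3 := by ring
    exact_mod_cast hnat
  refine ⟨max M (2 * (l + 1)), fun n r hn h => ?_, 3, by norm_num, fun n r hn h => ?_⟩
  · have hn1 : M < n := (le_max_left _ _).trans_lt hn
    have hn2 : 2 * (l + 1) < n := (le_max_right _ _).trans_lt hn
    have hn0 : 0 < n := by omega
    refine (LDPC.measureReal_rate_gt_le (F := F) h hn0 hl hld ε).trans ?_
    have h1 : (n : ℝ) ^ 3 ≤ (Fintype.card F : ℝ) ^ (n * ε / 2) := by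
      have h2 := hM n hn1.le
      rw [div_le_one (by positivity)] at h2
      refine h2.trans (le_of_eq ?_)
      rw [← Real.rpow_natCast, ← Real.rpow_mul hq0.le]
      ring_nf
    calc _ ≤ (Fintype.card F : ℝ) ^ (n * ε / 2) * (Fintype.card F : ℝ) ^ (-(n * ε)) :=
          mul_le_mul_of_nonneg_right ((poly n hn2).trans h1) (by positivity)
      _ = _ := by rw [← Real.rpow_add hq0]; ring_nf
  · have hn2 : 2 * (l + 1) < n := (le_max_right _ _).trans_lt hn
    have hn0 : 0 < n := by omega
    refine (LDPC.integral_rate_sub_le (F := F) h hn0 hl hld).trans ?_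
    rw [← mul_div_assoc]
    have h1 : Real.logb (Fintype.card F) ((n * l + 1) * (n + 1)) ≤
        3 * Real.logb (Fintype.card F) n := by
      have := Real.logb_le_logb_of_le hq (by positivity) (poly n hn2)
      rwa [Real.logb_pow] at this
    gcongr
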